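/- Let $\mathcal H$ be a complex separable infinite-dimensional Hilbert space. For a bounded real sequence $\xi=(\xi_n)_{n\ge 1}$ let $\xi^*_n=\inf\{\sup_{k\notin F}|\xi_k| : F\subset\mathbb N \text{ finite},\ |F|<n\}$ be its non-increasing rearrangement. A Banach symmetric sequence space is a non-zero real linear subspace $E\subset \ell_\infty$ with a complete norm $\|\cdot\|_E$ such that, whenever $\eta\in E$, $\xi\in\ell_\infty$ and $\xi^*_n\le \eta^*_n$ for all $n$, one has $\xi\in E$ and $\|\xi\|_E\le\|\eta\|_E$. Let $E\subset c_0$ be a Banach symmetric sequence space, and let $$\mathcal C_E=\{x : x \text{ is a compact operator on } \mathcal H,\ (s_n(x))_{n\ge 1}\in E\},\qquad \|x\|_{\mathcal C_E}=\|(s_n(x))_{n\ge1}\|_E,$$ where $s_1(x)\ge s_2(x)\ge\dots$ are the singular values of $x$, i.e. the eigenvalues of $|x|=(x^*x)^{1/2}$ in decreasing order, repeated according to multiplicity (and followed by zeros if $x$ has finite rank). Let $b_{\mathcal C_E}$ be the ball topology of $\mathcal C_E$, i.e. the coarsest topology on $\mathcal C_E$ in which every closed ball $\{y\in\mathcal C_E:\|y-c\|_{\mathcal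 C_E}\le r\}$, $c\in\mathcal C_E$, $r>0$, is closed. Let $x_n\in\mathcal C_E$ ($n\in\mathbb N$) be positive operators with $x_n\downarrow 0$, i.e. $x_{n+1}\le x_n$ for all $n$ and the infimum of $\{x_n\}$ in the self-adjoint part of $\mathcal C_E$ is $0$ (with $a\le b$ meaning that $b-a$ is a positive operator). Then the sequence $(x_n)$ converges with respect to $b_{\mathcal C_E}$ to at most one element of $\mathcal C_E$: if $x_n\to y$ and $x_n\to z$ in $b_{\mathcal C_E}$ with $y,z\in\mathcal C_E$, then $y=z$. -/

import Mathlib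

open Set Filter Topology

noncomputable section

/-- The non-increasing rearrangement of a bounded real sequence, indexed from `0`:
`ξ*ₙ = inf { sup_{k ∉ F} |ξ k| : F ⊆ ℕ finite, |F| < n + 1 }`. -/
def decreasingRearrangement (ξ : ℕ → ℝ) (n : ℕ) : ℝ :=
  ⨅ F : {F : Finset ℕ // F.card < n + 1}, ⨆ k : {k : ℕ // k ∉ F.1}, |ξ k.1|

/-- A real Banach symmetric sequence space: a nonzero linear subspace of the space of bounded real
sequences, with a complete norm, such that `y ∈ E`, `x` bounded and `x* ≤ y*` imply
`x ∈ E` and `‖x‖ ≤ ‖y‖`. -/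
structure BanachSymmetricSequenceSpace where
  /-- The underlying linear subspace of the space of all real sequences. -/
  carrier : Submodule ℝ (ℕ → ℝ)
  bounded : ∀ x ∈ carrier, BddAbove (range fun k => |x k|)
  nonzero : carrier ≠ ⊥
  /-- The norm of the space. -/
  norm : Seminorm ℝ carrier
  eq_zero_of_norm : ∀ x : carrier, norm x = 0 → x = 0
  complete : ∀ u : ℕ → carrier,
    (∀ ε > 0, ∃ N, ∀ m ≥ N, ∀ n ≥ N, norm (u m - u n) < ε) →
      ∃ a : carrier, Tendsto (fun n => norm (u n - a)) atTop (𝓝 0)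
  symmetric : ∀ (y : carrier) (x : ℕ → ℝ), BddAbove (range fun k => |x k|) →
    (∀ n, decreasingRearrangement x n ≤ decreasingRearrangement y n) →
      ∃ hx : x ∈ carrier, norm ⟨x, hx⟩ ≤ norm y

section Operators

variable {H : Type*} [NormedAddCommGroup H] [InnerProductSpace ℂ H] [CompleteSpace H]

/-- The span of all eigenvectors of `|x| = (x* x)^{1/2}` belonging to eigenvalues `> t`; its
dimension is the number of eigenvalues of `|x|` greater than `t`, counted with multiplicity. -/
def absEigenspan (x : H →L[ℂ] H) (t : ℝ) : Submodule ℂ H :=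
  ⨆ μ : {μ : ℝ // t < μ},
    Module.End.eigenspace ((CFC.abs x : H →L[ℂ] H) : H →ₗ[ℂ] H) ((μ.1 : ℝ) : ℂ)

/-- The singular values of a compact operator `x`, indexed from `0`: the eigenvalues of `|x|` in
decreasing order, repeated according to multiplicity (and followed by zeros if `x` has finite
rank). The `n`-th one is the least `t ≥ 0` such that at most `n` eigenvalues of `|x|`, counted with
multiplicity, are greater than `t`. -/
def singularValue (x : H →L[ℂ] H) (n : ℕ) : ℝ :=
  sInf {t : ℝ | 0 ≤ t ∧ Module.rank ℂ (absEigenspan x t) ≤ (n : Cardinal)}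

end Operators

/-- The ideal `C_E` of all compact operators on `H` whose sequence of singular values is
in `E`. -/
def SymmetricIdeal (E : BanachSymmetricSequenceSpace) (H : Type*) [NormedAddCommGroup H]
    [InnerProductSpace ℂ H] [CompleteSpace H] : Type _ :=
  {x : H →L[ℂ] H // IsCompactOperator x ∧ singularValue x ∈ E.carrier}

namespace SymmetricIdeal

variable {E : BanachSymmetricSequenceSpace} {H : Type*} [NormedAddCommGroup H]
  [InnerProductSpace ℂ H] [CompleteSpace H]

/-- The closed ball `{y ∈ C_E : ‖y - c‖ ≤ r}`, where the norm of `C_E` is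
`‖z‖ = ‖(sₙ(z))ₙ‖_E`. -/
def closedBall (c : SymmetricIdeal E H) (r : ℝ) : Set (SymmetricIdeal E H) :=
  {y | ∃ h : singularValue (y.1 - c.1) ∈ E.carrier, E.norm ⟨singularValue (y.1 - c.1), h⟩ ≤ r}

/-- The ball topology of `C_E`: the coarsest topology in which every closed ball of the norm of
`C_E` is closed. -/
@[reducible] def ballTopology (E : BanachSymmetricSequenceSpace) (H : Type*) [NormedAddCommGroup H]
    [InnerProductSpace ℂ H] [CompleteSpace H] : TopologicalSpace (SymmetricIdeal E H) :=
  TopologicalSpace.generateFrom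
    {U | ∃ (c : SymmetricIdeal E H) (r : ℝ), 0 < r ∧ U = (closedBall c r)ᶜ}

/-- `xₙ ↓ 0`: the sequence consists of positive operators, is decreasing, and has infimum `0` in
the self-adjoint part of `C_E`. The order is that of operators:
`a ≤ b` if and only if `b - a` is positive. -/
def DecreasesToZero (x : ℕ → SymmetricIdeal E H) : Prop :=
  (∀ n, 0 ≤ (x n).1) ∧ (∀ n, (x (n + 1)).1 ≤ (x n).1) ∧
    ∀ z : SymmetricIdeal E H, IsSelfAdjoint z.1 → (∀ n, z.1 ≤ (x n).1) → z.1 ≤ 0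

end SymmetricIdeal

end

/-! The only possible limit of `x n` is `0`. Suppose `w ≠ 0` is a limit, let `e` be a unit vector in
the range of `w`, and let `U` be the reflection in the line `ℂ ∙ e`. For every `T`, the operator `T
+ U T` has range in `ℂ ∙ e`, and `D = w + U w` is not zero.

A limit in the ball topology gives: `‖T + w‖ > r` implies `‖T + x n‖ > r` for all large `n`. Since
`U` is isometric and `U² = 1`, each of the two terms of `w + U w` can be replaced in turn, so `‖A +
D‖ > r` yields `‖A + x n + U (x n')‖ > r` with `n' ≥ n` as large as desired. Here `x n + U (x n') =
(x n - x n') + (x n' + U (x n'))`, and the last bracket has operator norm at most `2 ‖x n' e‖`,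
which is small because `x n → 0` strongly.

Applied to all the summands of `N • D`, this leaves an operator `u + h` of norm greater than `r`.
The differences come from successive index intervals, so `0 ≤ u ≤ x 0`; all the small terms have
range in the same line, so `h` has rank at most one, with `‖h‖ ≤ 1`. Such sums are bounded in `C_E`
by a constant `K` depending only on `x 0` (`exists_normLE_add`), while `‖N • D‖ > K` for large `N`.
Taking `r = K` gives a contradiction.

The rest supplies the needed facts on `C_E`: strong limits of decreasing sequences, inequalities for
singular values, and stability under sums. -/

noncomputable section

set_option linter.unusedSectionVars false

/-! ### Positive operators: compactness by domination, strong limits of decreasing sequences. -/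

section PositiveOperators

variable {H : Type*} [NormedAddCommGroup H] [InnerProductSpace ℂ H] [CompleteSpace H]

/-- Cauchy-Schwarz for the form of a positive operator. -/
theorem norm_apply_sq_le_of_nonneg {T : H →L[ℂ] H} (hT : 0 ≤ T) (v : H) :
    ‖T v‖ ^ 2 ≤ ‖T‖ * (inner ℂ (T v) v).re := by
  obtain ⟨b, rfl⟩ := CStarAlgebra.nonneg_iff_eq_star_mul_self.mp hT
  have h1 : inner ℂ ((star b * b) v) v = ((‖b v‖ ^ 2 : ℝ) : ℂ) := by
    rw [ContinuousLinearMap.star_eq_adjoint, mul_apply_eq_comp,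
      ContinuousLinearMap.adjoint_inner_left, inner_self_eq_norm_sq_to_K]
    norm_cast
  rw [h1, CStarRing.norm_star_mul_self, Complex.ofReal_re]
  have h2 : ‖(star b * b) v‖ ≤ ‖b‖ * ‖b v‖ := by
    rw [mul_apply_eq_comp, ← norm_star b]
    exact (star b).le_opNorm _
  calc ‖(star b * b) v‖ ^ 2 ≤ (‖b‖ * ‖b v‖) ^ 2 := by gcongr
    _ = _ := by ring

theorem re_inner_apply_le_of_le {S T : H →L[ℂ] H} (h : S ≤ T) (v : H) :
    (inner ℂ (S v) v).re ≤ (inner ℂ (T v) v).re := by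
  have h1 := ((ContinuousLinearMap.le_def S T).mp h).re_inner_nonneg_left v
  simp only [sub_apply, inner_sub_left] at h1
  simpa using h1

theorem re_inner_apply_nonneg {T : H →L[ℂ] H} (hT : 0 ≤ T) (v : H) :
    0 ≤ (inner ℂ (T v) v).re := by
  simpa using re_inner_apply_le_of_le hT v

theorem re_inner_le_norm_mul_norm (v w : H) : (inner ℂ v w).re ≤ ‖v‖ * ‖w‖ :=
  (Complex.re_le_norm _).trans (norm_inner_le_norm v w)

theorem norm_abs_apply (x : H →L[ℂ] H) (v : H) : ‖(CFC.abs x : H →L[ℂ] H) v‖ = ‖x v‖ := by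
  have key : ∀ T : H →L[ℂ] H, ((‖T v‖ ^ 2 : ℝ) : ℂ) = inner ℂ ((star T * T) v) v := by
    intro T
    rw [ContinuousLinearMap.star_eq_adjoint, mul_apply_eq_comp,
      ContinuousLinearMap.adjoint_inner_left, inner_self_eq_norm_sq_to_K]
    norm_cast
  have h2 : ((‖(CFC.abs x : H →L[ℂ] H) v‖ ^ 2 : ℝ) : ℂ) = ((‖x v‖ ^ 2 : ℝ) : ℂ) := by
    rw [key, key, (CFC.abs_nonneg x).star_eq, CFC.abs_mul_abs]
  have h3 : ‖(CFC.abs x : H →L[ℂ] H) v‖ ^ 2 = ‖x v‖ ^ 2 := by exact_mod_cast h2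
  exact (sq_eq_sq₀ (norm_nonneg _) (norm_nonneg _)).mp h3

/-- An operator controlled by a compact one is compact. -/
theorem isCompactOperator_of_norm_sq_le {A T : H →L[ℂ] H} (hT : IsCompactOperator T) (C : ℝ)
    (h : ∀ v, ‖A v‖ ^ 2 ≤ C * (‖T v‖ * ‖v‖)) : IsCompactOperator A := by
  refine (isCompactOperator_iff_isCompact_closure_image_ball (A : H →ₗ[ℂ] H) one_pos).mpr ?_
  have hT' := IsCompactOperator.isCompact_closure_image_ball (f := (T : H →ₗ[ℂ] H)) hT 1
  refine TotallyBounded.isCompact_of_isClosed (TotallyBounded.closure ?_) isClosed_closure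
  have hTB : TotallyBounded (T '' Metric.ball 0 1) :=
    hT'.totallyBounded.subset subset_closure
  rw [Metric.totallyBounded_iff]
  intro ε hε
  -- Differences of points of the unit ball have norm at most `2`, so a `δ`-net of the image under
  -- `T` gives an `ε`-net of the image under `A` once `2 |C| δ < ε ^ 2`.
  set δ : ℝ := ε ^ 2 / (2 * (|C| + 1)) with hδ
  have hδ0 : 0 < δ := by positivity
  obtain ⟨s, hs, hsf, hcov⟩ := Metric.finite_approx_of_totallyBounded hTB δ hδ0
  have hs' : ∀ w ∈ s, ∃ v, v ∈ Metric.ball (0 : H) 1 ∧ T v = w := fun w hw => hs hw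
  choose! g hg hgs using hs'
  refine ⟨(fun w => A (g w)) '' s, hsf.image _, ?_⟩
  rintro _ ⟨v, hv, rfl⟩
  obtain ⟨w, hw, hvw⟩ := mem_iUnion₂.mp (hcov ⟨v, hv, rfl⟩)
  refine mem_iUnion₂.mpr ⟨A (g w), ⟨w, hw, rfl⟩, ?_⟩
  have h1 : ‖T (v - g w)‖ < δ := by
    rw [map_sub, hgs w hw, ← dist_eq_norm]; exact hvw
  have h2 : ‖v - g w‖ ≤ 2 := by
    have h3 : ‖v‖ < 1 := by simpa using hv
    have h4 : ‖g w‖ < 1 := by simpa using hg w hw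
    linarith [norm_sub_le v (g w)]
  have h5 : ‖A (v - g w)‖ ^ 2 < ε ^ 2 := by
    calc ‖A (v - g w)‖ ^ 2 ≤ C * (‖T (v - g w)‖ * ‖v - g w‖) := h _
      _ ≤ |C| * (δ * 2) := by
        gcongr
        exact le_abs_self C
      _ < (|C| + 1) * (δ * 2) := by gcongr; linarith
      _ = ε ^ 2 := by rw [hδ]; field_simp
  have h6 : ‖A (v - g w)‖ < ε := lt_of_pow_lt_pow_left₀ 2 hε.le h5
  show dist (A v) (A (g w)) < ε
  rwa [dist_eq_norm, ← map_sub]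

theorem IsCompactOperator.abs {x : H →L[ℂ] H} (hx : IsCompactOperator x) :
    IsCompactOperator (CFC.abs x : H →L[ℂ] H) := by
  refine isCompactOperator_of_norm_sq_le hx ‖x‖ fun v => ?_
  rw [norm_abs_apply]
  nlinarith [x.le_opNorm v, norm_nonneg (x v)]

theorem IsCompactOperator.of_nonneg_of_le {S T : H →L[ℂ] H} (hT : IsCompactOperator T)
    (h0 : 0 ≤ S) (hST : S ≤ T) : IsCompactOperator S := by
  refine isCompactOperator_of_norm_sq_le hT ‖S‖ fun v => (norm_apply_sq_le_of_nonneg h0 v).trans ?_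
  gcongr
  exact (re_inner_apply_le_of_le hST v).trans (re_inner_le_norm_mul_norm _ _)

/-- A decreasing sequence of positive operators converges strongly to a positive lower bound. -/
theorem exists_tendsto_of_antitone_of_nonneg {x : ℕ → H →L[ℂ] H} (h0 : ∀ n, 0 ≤ x n)
    (hx : Antitone x) :
    ∃ L : H →L[ℂ] H, 0 ≤ L ∧ (∀ n, L ≤ x n) ∧ ∀ v, Tendsto (fun n => x n v) atTop (𝓝 (L v)) := by
  have hnorm : ∀ m n, m ≤ n → ‖x m - x n‖ ≤ ‖x 0‖ := fun m n hmn =>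
    CStarAlgebra.norm_le_norm_of_nonneg_of_le (a := x m - x n) (b := x 0)
      (sub_nonneg.mpr (hx hmn)) ((sub_le_self _ (h0 n)).trans (hx (Nat.zero_le m)))
  have hcauchy : ∀ v, CauchySeq fun n => x n v := by
    intro v
    set a : ℕ → ℝ := fun n => (inner ℂ (x n v) v).re with ha
    have hanti : Antitone a := fun m n hmn => re_inner_apply_le_of_le (hx hmn) v
    have hbdd : BddBelow (range a) := ⟨0, by rintro _ ⟨n, rfl⟩; exact re_inner_apply_nonneg (h0 n) v⟩
    have hac : CauchySeq a := (tendsto_atTop_ciInf hanti hbdd).cauchySeq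
    rw [Metric.cauchySeq_iff'] at hac ⊢
    intro ε hε
    obtain ⟨N, hN⟩ := hac (ε ^ 2 / (‖x 0‖ + 1)) (by positivity)
    refine ⟨N, fun n hn => ?_⟩
    -- Cauchy-Schwarz for `x N - x n ≥ 0` turns the scalar Cauchy property of the forms into the
    -- Cauchy property of the vectors.
    have h1 := norm_apply_sq_le_of_nonneg (sub_nonneg.mpr (hx hn)) v
    have h2 : (inner ℂ ((x N - x n) v) v).re = a N - a n := by
      simp [ha]
    have h3 : a N - a n < ε ^ 2 / (‖x 0‖ + 1) := by
      have := hN n hn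
      rw [dist_comm, Real.dist_eq] at this
      exact (le_abs_self _).trans_lt this
    have h4 : 0 ≤ a N - a n := sub_nonneg.mpr (hanti hn)
    have h5 : ‖(x N - x n) v‖ ^ 2 < ε ^ 2 := by
      calc ‖(x N - x n) v‖ ^ 2 ≤ ‖x N - x n‖ * (a N - a n) := h2 ▸ h1
        _ ≤ ‖x 0‖ * (a N - a n) := by gcongr; exact hnorm N n hn
        _ ≤ (‖x 0‖ + 1) * (a N - a n) := by gcongr; linarith
        _ < (‖x 0‖ + 1) * (ε ^ 2 / (‖x 0‖ + 1)) := by gcongr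
        _ = ε ^ 2 := by field_simp
    rw [dist_comm, dist_eq_norm, ← sub_apply]
    exact lt_of_pow_lt_pow_left₀ 2 hε.le h5
  choose f hf using fun v => cauchySeq_tendsto_of_complete (hcauchy v)
  let L : H →L[ℂ] H := continuousLinearMapOfTendsto x (f := f) (tendsto_pi_nhds.mpr hf)
  have hL : ∀ v, L v = f v := fun v => rfl
  have hform : ∀ v, Tendsto (fun n => inner ℂ (x n v) v) atTop (𝓝 (inner ℂ (L v) v)) := fun v =>
    (hf v).inner tendsto_const_nhds
  refine ⟨L, ?_, fun n => ?_, hf⟩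
  · rw [ContinuousLinearMap.nonneg_iff_isPositive, ContinuousLinearMap.isPositive_iff_complex]
    intro v
    have h1 : ∀ n, inner ℂ (x n v) v ∈ {z : ℂ | (z.re : ℂ) = z ∧ 0 ≤ z.re} := fun n =>
      (ContinuousLinearMap.isPositive_iff_complex _).mp
        ((ContinuousLinearMap.nonneg_iff_isPositive _).mp (h0 n)) v
    have hcl : IsClosed {z : ℂ | (z.re : ℂ) = z ∧ 0 ≤ z.re} :=
      (isClosed_eq (by fun_prop) continuous_id).inter
        (isClosed_le continuous_const Complex.continuous_re)
    exact hcl.mem_of_tendsto (hform v) (Eventually.of_forall h1)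
  · rw [ContinuousLinearMap.le_def, ContinuousLinearMap.isPositive_iff_complex]
    intro v
    have h1 : ∀ᶠ m in atTop,
        inner ℂ ((x n - x m) v) v ∈ {z : ℂ | (z.re : ℂ) = z ∧ 0 ≤ z.re} := by
      filter_upwards [eventually_ge_atTop n] with m hm
      exact (ContinuousLinearMap.isPositive_iff_complex _).mp
        ((ContinuousLinearMap.le_def _ _).mp (hx hm)) v
    have hcl : IsClosed {z : ℂ | (z.re : ℂ) = z ∧ 0 ≤ z.re} :=
      (isClosed_eq (by fun_prop) continuous_id).inter
        (isClosed_le continuous_const Complex.continuous_re)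
    refine hcl.mem_of_tendsto ?_ h1
    simp only [sub_apply, inner_sub_left]
    exact tendsto_const_nhds.sub (hform v)

end PositiveOperators

/-! ### Singular values of compact operators. -/

section SingularValues

variable {H : Type*} [NormedAddCommGroup H] [InnerProductSpace ℂ H] [CompleteSpace H]

/-- A finite sum of eigenvectors of a symmetric operator, by Pythagoras. -/
theorem exists_eigenvector_decomposition {A : H →ₗ[ℂ] H} (hA : A.IsSymmetric) (P : ℝ → Prop)
    {v : H} (hv : v ∈ ⨆ μ : {μ : ℝ // P μ}, Module.End.eigenspace A ((μ.1 : ℝ) : ℂ)) :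
    ∃ (F : Finset {μ : ℝ // P μ}) (f : {μ : ℝ // P μ} → H), v = ∑ i ∈ F, f i ∧
      ‖v‖ ^ 2 = ∑ i ∈ F, ‖f i‖ ^ 2 ∧
      (inner ℂ (A v) v).re = ∑ i ∈ F, i.1 * ‖f i‖ ^ 2 ∧
      ‖A v‖ ^ 2 = ∑ i ∈ F, i.1 ^ 2 * ‖f i‖ ^ 2 := by
  obtain ⟨f, hf, rfl⟩ := (Submodule.mem_iSup_iff_exists_finsupp _ _).mp hv
  have hV : OrthogonalFamily ℂ (fun i : {μ : ℝ // P μ} => Module.End.eigenspace A ((i.1 : ℝ) : ℂ))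
      fun i => (Module.End.eigenspace A ((i.1 : ℝ) : ℂ)).subtypeₗᵢ :=
    hA.orthogonalFamily_eigenspaces.comp (f := fun i : {μ : ℝ // P μ} => ((i.1 : ℝ) : ℂ))
      (Complex.ofReal_injective.comp Subtype.val_injective)
  let l : ∀ i : {μ : ℝ // P μ}, Module.End.eigenspace A ((i.1 : ℝ) : ℂ) := fun i => ⟨f i, hf i⟩
  let l' : ∀ i : {μ : ℝ // P μ}, Module.End.eigenspace A ((i.1 : ℝ) : ℂ) :=
    fun i => ((i.1 : ℝ) : ℂ) • l i
  have h1 : (f.sum fun _ xi => xi) =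
      ∑ i ∈ f.support, (Module.End.eigenspace A ((i.1 : ℝ) : ℂ)).subtypeₗᵢ (l i) := rfl
  have h2 : A (f.sum fun _ xi => xi) =
      ∑ i ∈ f.support, (Module.End.eigenspace A ((i.1 : ℝ) : ℂ)).subtypeₗᵢ (l' i) := by
    rw [h1, map_sum]
    refine Finset.sum_congr rfl fun i _ => ?_
    exact Module.End.mem_eigenspace_iff.mp (hf i)
  refine ⟨f.support, f, rfl, ?_, ?_, ?_⟩
  · rw [h1, hV.norm_sum]; rfl
  · rw [h2, h1, hV.inner_sum, Complex.re_sum]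
    refine Finset.sum_congr rfl fun i _ => ?_
    show (inner ℂ (((i.1 : ℝ) : ℂ) • f i) (f i)).re = _
    rw [inner_smul_left, Complex.conj_ofReal, Complex.re_ofReal_mul, inner_self_eq_norm_sq_to_K]
    norm_cast
  · rw [h2, hV.norm_sum]
    refine Finset.sum_congr rfl fun i _ => ?_
    show ‖((i.1 : ℝ) : ℂ) • f i‖ ^ 2 = _
    rw [norm_smul, mul_pow, Complex.norm_real, Real.norm_eq_abs, sq_abs]

theorem isSymmetric_abs (x : H →L[ℂ] H) :
    ((CFC.abs x : H →L[ℂ] H) : H →ₗ[ℂ] H).IsSymmetric :=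
  ((ContinuousLinearMap.nonneg_iff_isPositive _).mp (CFC.abs_nonneg x)).isSymmetric

/-- If the form of `|x|` is bounded by `t` on the orthogonal complement of a subspace of dimension
at most `n`, then at most `n` eigenvalues of `|x|` are greater than `t`. -/
theorem singularValue_le_of_re_inner_le {x : H →L[ℂ] H} {n : ℕ} {t : ℝ} (ht : 0 ≤ t)
    (W : Submodule ℂ H) (hW : Module.rank ℂ W ≤ n)
    (h : ∀ v ∈ Wᗮ, (inner ℂ ((CFC.abs x : H →L[ℂ] H) v) v).re ≤ t * ‖v‖ ^ 2) :
    singularValue x n ≤ t := by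
  refine csInf_le ⟨0, fun s hs => hs.1⟩ ⟨ht, le_trans ?_ hW⟩
  have hfd : FiniteDimensional ℂ W :=
    Module.rank_lt_aleph0_iff.mp (hW.trans_lt (Cardinal.natCast_lt_aleph0))
  -- The projection to `W` is injective on the eigenspan: on its kernel the form is at most `t ‖v‖ ^
  -- 2`, whereas it exceeds this on nonzero sums of eigenvectors with eigenvalues above `t`.
  let φ : absEigenspan x t →ₗ[ℂ] W :=
    (W.orthogonalProjectionOnto : H →ₗ[ℂ] W) ∘ₗ (absEigenspan x t).subtype
  refine LinearMap.rank_le_of_injective φ ((injective_iff_map_eq_zero φ).mpr ?_)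
  rintro ⟨v, hv⟩ hφ
  have hvW : v ∈ Wᗮ := by
    rw [← Submodule.ker_orthogonalProjectionOnto]
    exact hφ
  obtain ⟨F, f, hvf, hn, hi, -⟩ := exists_eigenvector_decomposition (isSymmetric_abs x) _ hv
  have h1 := h v hvW
  rw [ContinuousLinearMap.coe_coe] at hi
  rw [hi, hn, Finset.mul_sum, ← sub_nonneg, ← Finset.sum_sub_distrib] at h1
  have h2 : ∀ i ∈ F, t * ‖f i‖ ^ 2 - i.1 * ‖f i‖ ^ 2 ≤ 0 := fun i _ => by
    nlinarith [i.2, sq_nonneg ‖f i‖]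
  have h3 := (Finset.sum_eq_zero_iff_of_nonpos h2).mp (le_antisymm (Finset.sum_nonpos h2) h1)
  have h4 : ∀ i ∈ F, f i = 0 := fun i hi => by
    have h5 := h3 i hi
    have h6 : (t - i.1) * ‖f i‖ ^ 2 = 0 := by linarith
    rcases mul_eq_zero.mp h6 with h7 | h7
    · exact absurd i.2 (by linarith)
    · simpa using h7
  ext
  simp only [ZeroMemClass.coe_zero]
  rw [hvf, Finset.sum_eq_zero h4]

theorem singularValue_le_of_norm_le {x : H →L[ℂ] H} {n : ℕ} {t : ℝ} (ht : 0 ≤ t)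
    (W : Submodule ℂ H) (hW : Module.rank ℂ W ≤ n) (h : ∀ v ∈ Wᗮ, ‖x v‖ ≤ t * ‖v‖) :
    singularValue x n ≤ t :=
  singularValue_le_of_re_inner_le ht W hW fun v hv =>
    calc _ ≤ ‖(CFC.abs x : H →L[ℂ] H) v‖ * ‖v‖ := re_inner_le_norm_mul_norm _ _
      _ = ‖x v‖ * ‖v‖ := by rw [norm_abs_apply]
      _ ≤ t * ‖v‖ * ‖v‖ := by gcongr; exact h v hv
      _ = t * ‖v‖ ^ 2 := by ring

theorem absEigenspan_anti (x : H →L[ℂ] H) {s t : ℝ} (h : s ≤ t) :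
    absEigenspan x t ≤ absEigenspan x s :=
  iSup_le fun μ => le_iSup (fun ν : {ν : ℝ // s < ν} =>
    Module.End.eigenspace ((CFC.abs x : H →L[ℂ] H) : H →ₗ[ℂ] H) ((ν.1 : ℝ) : ℂ))
      ⟨μ.1, h.trans_lt μ.2⟩

theorem absEigenspan_norm (x : H →L[ℂ] H) : absEigenspan x ‖x‖ = ⊥ := by
  refine eq_bot_iff.mpr (iSup_le fun μ v hv => ?_)
  have h1 := Module.End.mem_eigenspace_iff.mp hv
  rw [ContinuousLinearMap.coe_coe] at h1
  have h2 : ‖x v‖ = |μ.1| * ‖v‖ := by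
    rw [← norm_abs_apply, h1, norm_smul, Complex.norm_real, Real.norm_eq_abs]
  have h3 := x.le_opNorm v
  have h4 : ‖x‖ < |μ.1| := μ.2.trans_le (le_abs_self _)
  by_contra hv0
  have : 0 < ‖v‖ := norm_pos_iff.mpr hv0
  nlinarith

theorem singularValue_set_nonempty (x : H →L[ℂ] H) (n : ℕ) :
    {t : ℝ | 0 ≤ t ∧ Module.rank ℂ (absEigenspan x t) ≤ (n : Cardinal)}.Nonempty :=
  ⟨‖x‖, norm_nonneg _, by rw [absEigenspan_norm]; simp⟩

theorem singularValue_nonneg (x : H →L[ℂ] H) (n : ℕ) : 0 ≤ singularValue x n :=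
  Real.sInf_nonneg fun _ ht => ht.1

theorem singularValue_le_norm (x : H →L[ℂ] H) (n : ℕ) : singularValue x n ≤ ‖x‖ :=
  csInf_le ⟨0, fun _ hs => hs.1⟩ ⟨norm_nonneg _, by rw [absEigenspan_norm]; simp⟩

theorem singularValue_antitone (x : H →L[ℂ] H) : Antitone (singularValue x) := fun m n hmn =>
  csInf_le_csInf ⟨0, fun _ hs => hs.1⟩ (singularValue_set_nonempty x m) fun _ ht =>
    ⟨ht.1, ht.2.trans (by exact_mod_cast hmn)⟩

theorem rank_absEigenspan_le {x : H →L[ℂ] H} {n : ℕ} {t : ℝ} (h : singularValue x n < t) :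
    Module.rank ℂ (absEigenspan x t) ≤ n := by
  obtain ⟨s, hs, hst⟩ := (csInf_lt_iff ⟨0, fun _ hs => hs.1⟩ (singularValue_set_nonempty x n)).mp h
  exact (Submodule.rank_mono (absEigenspan_anti x hst.le)).trans hs.2

/-- A compact operator `x` is bounded by `t` on the orthogonal complement of the eigenvectors of
`|x|` for eigenvalues greater than `t`. -/
theorem norm_apply_le_of_mem_orthogonal {x : H →L[ℂ] H} (hx : IsCompactOperator x) {t : ℝ}
    (ht : 0 ≤ t) {v : H} (hv : v ∈ (absEigenspan x t)ᗮ) : ‖x v‖ ≤ t * ‖v‖ := by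
  set A : H →L[ℂ] H := CFC.abs x with hA
  have hsymm : (A : H →ₗ[ℂ] H).IsSymmetric := isSymmetric_abs x
  set W := absEigenspan x t with hW
  set S : Submodule ℂ H := ⨆ μ : {μ : ℝ // 0 ≤ μ ∧ μ ≤ t},
    Module.End.eigenspace (A : H →ₗ[ℂ] H) ((μ.1 : ℝ) : ℂ) with hS
  -- Spectral theorem: the eigenvalues of `|x|` are real and nonnegative, so every eigenspace lies
  -- in `W` or in `S`. As `S ⊥ W`, it follows that `Wᗮ` is the closure of `S`, where the bound
  -- passes to limits.
  have hdense : (W ⊔ S)ᗮ = ⊥ := by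
    have hall := ContinuousLinearMap.orthogonalComplement_iSup_eigenspaces_eq_bot
      (IsCompactOperator.abs hx) hsymm
    refine eq_bot_iff.mpr (le_trans (Submodule.orthogonal_le (iSup_le fun μ => ?_)) hall.le)
    by_cases hμ : Module.End.eigenspace (A : H →ₗ[ℂ] H) μ = ⊥
    · exact hμ.le.trans bot_le
    obtain ⟨w, hw, hw0⟩ := Submodule.exists_mem_ne_zero_of_ne_bot hμ
    have hμr : ((μ.re : ℝ) : ℂ) = μ :=
      Complex.conj_eq_iff_re.mp (hsymm.conj_eigenvalue_eq_self hμ)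
    have hμ0 : 0 ≤ μ.re := by
      have h1 := re_inner_apply_nonneg (CFC.abs_nonneg x) w
      have h2 : A w = μ • w := Module.End.mem_eigenspace_iff.mp hw
      rw [← hA, h2, ← hμr, inner_smul_left, Complex.conj_ofReal, Complex.re_ofReal_mul,
        inner_self_eq_norm_sq_to_K] at h1
      norm_cast at h1
      have h3 : 0 < ‖w‖ ^ 2 := by positivity
      exact nonneg_of_mul_nonneg_left h1 h3
    rw [← hμr]
    rcases le_or_gt μ.re t with h | h
    · exact (le_iSup (fun μ : {μ : ℝ // 0 ≤ μ ∧ μ ≤ t} =>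
        Module.End.eigenspace (A : H →ₗ[ℂ] H) ((μ.1 : ℝ) : ℂ)) ⟨μ.re, hμ0, h⟩).trans le_sup_right
    · exact (le_iSup (fun μ : {μ : ℝ // t < μ} =>
        Module.End.eigenspace (A : H →ₗ[ℂ] H) ((μ.1 : ℝ) : ℂ)) ⟨μ.re, h⟩).trans le_sup_left
  have hSW : S ≤ Wᗮ := by
    refine iSup_le fun μ => (Submodule.isOrtho_iff_le.mp ?_)
    refine Submodule.isOrtho_iSup_right.mpr fun ν => ?_
    intro w hw
    rw [Submodule.mem_orthogonal]
    intro u hu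
    have hne : ((ν.1 : ℝ) : ℂ) ≠ ((μ.1 : ℝ) : ℂ) := by
      have := ν.2; have := μ.2.2
      exact fun h => absurd (Complex.ofReal_injective h) (by linarith)
    exact hsymm.orthogonalFamily_eigenspaces hne ⟨u, hu⟩ ⟨w, hw⟩
  have hvS : v ∈ S.topologicalClosure := by
    rw [← Submodule.orthogonal_orthogonal_eq_closure, Submodule.mem_orthogonal]
    intro w hw
    set K := S.topologicalClosure with hK
    have hKc : CompleteSpace K := S.isClosed_topologicalClosure.completeSpace_coe
    have hKW : K ≤ Wᗮ := S.topologicalClosure_minimal hSW W.isClosed_orthogonal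
    have h1 : v - K.starProjection v ∈ (W ⊔ S)ᗮ := by
      rw [← Submodule.inf_orthogonal]
      refine ⟨Wᗮ.sub_mem hv (hKW (K.starProjection_apply_mem v)), ?_⟩
      exact Submodule.orthogonal_le S.le_topologicalClosure (K.sub_starProjection_mem_orthogonal v)
    rw [hdense, Submodule.mem_bot, sub_eq_zero] at h1
    rw [← Submodule.orthogonal_closure] at hw
    rw [h1]
    exact (Submodule.mem_orthogonal' _ _).mp hw _ (K.starProjection_apply_mem v)
  have hcl : IsClosed {v : H | ‖x v‖ ≤ t * ‖v‖} :=
    isClosed_le (by fun_prop) (by fun_prop)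
  refine closure_minimal (fun w hw => ?_) hcl hvS
  obtain ⟨F, f, -, hn, -, hAn⟩ := exists_eigenvector_decomposition hsymm _ hw
  rw [ContinuousLinearMap.coe_coe] at hAn
  show ‖x w‖ ≤ t * ‖w‖
  rw [← norm_abs_apply]
  refine le_of_sq_le_sq ?_ (by positivity)
  rw [hAn, mul_pow, hn, Finset.mul_sum]
  refine Finset.sum_le_sum fun i _ => ?_
  have := i.2
  gcongr
  · exact this.1
  · exact this.2

/-- Converse of `singularValue_le_of_norm_le`. Together they describe the singular values without
`|x|`, as the least bound for `x` off a subspace of dimension at most `n`; the inequalities below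
rest on this. -/
theorem norm_apply_le_of_singularValue_lt {x : H →L[ℂ] H} (hx : IsCompactOperator x) {n : ℕ}
    {t : ℝ} (h : singularValue x n < t) :
    ∃ W : Submodule ℂ H, Module.rank ℂ W ≤ n ∧ ∀ v ∈ Wᗮ, ‖x v‖ ≤ t * ‖v‖ :=
  ⟨absEigenspan x t, rank_absEigenspan_le h, fun _ hv =>
    norm_apply_le_of_mem_orthogonal hx ((singularValue_nonneg x n).trans h.le) hv⟩

theorem norm_le_singularValue_zero {x : H →L[ℂ] H} (hx : IsCompactOperator x) :
    ‖x‖ ≤ singularValue x 0 := by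
  refine le_of_forall_gt_imp_ge_of_dense fun t ht => ?_
  obtain ⟨W, hW, h⟩ := norm_apply_le_of_singularValue_lt hx ht
  have hW' : W = ⊥ := by
    rw [← Submodule.rank_eq_zero]
    simpa using hW
  exact x.opNorm_le_bound ((singularValue_nonneg x 0).trans ht.le) fun v => h v (by simp [hW'])

/-- Off the sum of the two exceptional subspaces, of dimension at most `m + n`, both bounds hold. -/
theorem singularValue_add_le {x y : H →L[ℂ] H} (hx : IsCompactOperator x)
    (hy : IsCompactOperator y) (m n : ℕ) :
    singularValue (x + y) (m + n) ≤ singularValue x m + singularValue y n := by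
  refine le_of_forall_pos_le_add fun ε hε => ?_
  obtain ⟨V, hV, hxV⟩ := norm_apply_le_of_singularValue_lt hx
    (lt_add_of_pos_right (singularValue x m) (half_pos hε))
  obtain ⟨W, hW, hyW⟩ := norm_apply_le_of_singularValue_lt hy
    (lt_add_of_pos_right (singularValue y n) (half_pos hε))
  have hx0 := singularValue_nonneg x m
  have hy0 := singularValue_nonneg y n
  refine singularValue_le_of_norm_le (by positivity) (V ⊔ W) ?_ fun v hv => ?_
  · push_cast
    exact (Submodule.rank_add_le_rank_add_rank V W).trans (add_le_add hV hW)
  · rw [← Submodule.inf_orthogonal] at hv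
    calc ‖(x + y) v‖ ≤ ‖x v‖ + ‖y v‖ := norm_add_le _ _
      _ ≤ _ := add_le_add (hxV v hv.1) (hyW v hv.2)
      _ = _ := by ring

theorem singularValue_le_of_norm_apply_le {x y : H →L[ℂ] H} (hx : IsCompactOperator x)
    (h : ∀ v, ‖y v‖ ≤ ‖x v‖) (n : ℕ) : singularValue y n ≤ singularValue x n := by
  refine le_of_forall_gt_imp_ge_of_dense fun t ht => ?_
  obtain ⟨W, hW, hxW⟩ := norm_apply_le_of_singularValue_lt hx ht
  exact singularValue_le_of_norm_le ((singularValue_nonneg x n).trans ht.le) W hW fun v hv =>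
    (h v).trans (hxW v hv)

/-- Here `‖y v‖ ≤ ‖x v‖` may fail, but `|y| = y`, so it is enough to compare quadratic forms. -/
theorem singularValue_le_of_le {x y : H →L[ℂ] H} (hx : IsCompactOperator x) (hy : 0 ≤ y)
    (h : y ≤ x) (n : ℕ) : singularValue y n ≤ singularValue x n := by
  refine le_of_forall_gt_imp_ge_of_dense fun t ht => ?_
  obtain ⟨W, hW, hxW⟩ := norm_apply_le_of_singularValue_lt hx ht
  refine singularValue_le_of_re_inner_le ((singularValue_nonneg x n).trans ht.le) W hW
    fun v hv => ?_
  rw [CFC.abs_of_nonneg y hy]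
  calc _ ≤ _ := re_inner_apply_le_of_le h v
    _ ≤ ‖x v‖ * ‖v‖ := re_inner_le_norm_mul_norm _ _
    _ ≤ t * ‖v‖ * ‖v‖ := by gcongr; exact hxW v hv
    _ = _ := by ring

theorem singularValue_congr {x y : H →L[ℂ] H} (hx : IsCompactOperator x)
    (hy : IsCompactOperator y) (h : ∀ v, ‖y v‖ = ‖x v‖) : singularValue y = singularValue x :=
  funext fun n => le_antisymm (singularValue_le_of_norm_apply_le hx (fun v => (h v).le) n)
    (singularValue_le_of_norm_apply_le hy (fun v => (h v).ge) n)

end SingularValues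

/-! ### Symmetric sequence spaces. -/

section Sequences

theorem BddAbove.iSup_abs_compl_le {ξ η : ℕ → ℝ} (hη : BddAbove (range fun k => |η k|))
    (σ : ℕ → ℕ) (hle : ∀ k, ξ k ≠ 0 → |ξ k| ≤ |η (σ k)|) {F G : Finset ℕ}
    (hG : ∀ k, ξ k ≠ 0 → σ k ∈ F → k ∈ G) :
    ⨆ k : {k : ℕ // k ∉ G}, |ξ k.1| ≤ ⨆ k : {k : ℕ // k ∉ F}, |η k.1| := by
  have h0 : 0 ≤ ⨆ k : {k : ℕ // k ∉ F}, |η k.1| := Real.iSup_nonneg fun _ => abs_nonneg _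
  refine Real.iSup_le (fun k => ?_) h0
  by_cases hk : ξ k.1 = 0
  · simpa [hk] using h0
  · have hF : σ k.1 ∉ F := fun h => k.2 (hG _ hk h)
    refine (hle _ hk).trans (le_ciSup (f := fun k : {k : ℕ // k ∉ F} => |η k.1|) ?_ ⟨σ k.1, hF⟩)
    exact hη.mono (by rintro _ ⟨j, rfl⟩; exact ⟨j.1, rfl⟩)

/-- If the nonzero entries of `ξ` are dominated by distinct entries of `η`, then `ξ* ≤ η*`. -/
theorem decreasingRearrangement_le {ξ η : ℕ → ℝ} (hη : BddAbove (range fun k => |η k|))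
    (σ : ℕ → ℕ) (hσ : InjOn σ {k | ξ k ≠ 0}) (hle : ∀ k, ξ k ≠ 0 → |ξ k| ≤ |η (σ k)|) (n : ℕ) :
    decreasingRearrangement ξ n ≤ decreasingRearrangement η n := by
  have : Nonempty {F : Finset ℕ // F.card < n + 1} := ⟨⟨∅, by simp⟩⟩
  refine le_ciInf fun F => ?_
  -- The support indices sent into `F` are no more numerous than `F`, by injectivity; removing them
  -- from `ξ` competes with removing `F` from `η`.
  have hfin : (σ ⁻¹' (F.1 : Set ℕ) ∩ {k | ξ k ≠ 0}).Finite := by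
    have h := Set.Finite.preimage (s := (F.1 : Set ℕ)) (f := fun k : {k | ξ k ≠ 0} => σ k.1)
      (fun a _ b _ hab => Subtype.ext (hσ a.2 b.2 hab)) F.1.finite_toSet
    refine (h.image Subtype.val).subset ?_
    rintro k ⟨hk, hk0⟩
    exact ⟨⟨k, hk0⟩, hk, rfl⟩
  set G : Finset ℕ := hfin.toFinset with hG
  have hcard : G.card ≤ F.1.card := by
    refine Finset.card_le_card_of_injOn σ (fun k hk => ?_) (fun a ha b hb hab => ?_)
    · exact ((hfin.mem_toFinset).mp hk).1
    · exact hσ ((hfin.mem_toFinset).mp ha).2 ((hfin.mem_toFinset).mp hb).2 hab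
  refine (ciInf_le (f := fun F : {F : Finset ℕ // F.card < n + 1} =>
    ⨆ k : {k : ℕ // k ∉ F.1}, |ξ k.1|) ⟨0, ?_⟩ ⟨G, hcard.trans_lt F.2⟩).trans ?_
  · rintro _ ⟨F, rfl⟩
    exact Real.iSup_nonneg fun _ => abs_nonneg _
  · exact hη.iSup_abs_compl_le σ hle fun k hk hkF => (hfin.mem_toFinset).mpr ⟨hkF, hk⟩

namespace BanachSymmetricSequenceSpace

variable (E : BanachSymmetricSequenceSpace)

theorem exists_mem_norm_le {ξ : ℕ → ℝ} (η : E.carrier) (σ : ℕ → ℕ)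
    (hσ : InjOn σ {k | ξ k ≠ 0}) (hle : ∀ k, ξ k ≠ 0 → |ξ k| ≤ |η.1 (σ k)|) :
    ∃ hξ : ξ ∈ E.carrier, E.norm ⟨ξ, hξ⟩ ≤ E.norm η := by
  have hη := E.bounded η.1 η.2
  refine E.symmetric η ξ ?_ (decreasingRearrangement_le hη σ hσ hle)
  obtain ⟨C, hC⟩ := hη
  refine ⟨max C 0, ?_⟩
  rintro _ ⟨k, rfl⟩
  show |ξ k| ≤ max C 0
  by_cases hk : ξ k = 0
  · simp [hk]
  · exact ((hle k hk).trans (hC ⟨σ k, rfl⟩)).trans (le_max_left _ _)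

theorem exists_mem_norm_le_of_abs_le {ξ : ℕ → ℝ} (η : E.carrier) (hle : ∀ k, |ξ k| ≤ |η.1 k|) :
    ∃ hξ : ξ ∈ E.carrier, E.norm ⟨ξ, hξ⟩ ≤ E.norm η :=
  E.exists_mem_norm_le η id (injOn_id _) fun k _ => hle k

theorem single_mem : Pi.single 0 1 ∈ E.carrier := by
  obtain ⟨η, hη, hη0⟩ := Submodule.exists_mem_ne_zero_of_ne_bot E.nonzero
  obtain ⟨k, hk⟩ := Function.ne_iff.mp hη0
  have h : ∀ j, (Pi.single 0 1 : ℕ → ℝ) j ≠ 0 → j = 0 := fun j hj => by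
    by_contra h
    exact hj (Pi.single_eq_of_ne h 1)
  refine (E.exists_mem_norm_le ⟨(η k)⁻¹ • η, E.carrier.smul_mem _ hη⟩ (fun _ => k)
    (fun a ha b hb _ => (h a ha).trans (h b hb).symm) fun j hj => ?_).1
  have hk' : η k ≠ 0 := hk
  rw [h j hj]
  simp [hk']

theorem norm_single_pos : 0 < E.norm ⟨Pi.single 0 1, E.single_mem⟩ := by
  refine lt_of_le_of_ne (apply_nonneg _ _) fun h => ?_
  have h1 := congrArg Subtype.val (E.eq_zero_of_norm _ h.symm)
  simpa using congrFun h1 0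

/-- The map `n ↦ n / 2` is injective on each parity class, so the even and odd parts of `ξ` are each
dominated by a rearrangement of `η`. -/
theorem mem_of_le_half {ξ : ℕ → ℝ} (hξ : ∀ n, 0 ≤ ξ n) {η : ℕ → ℝ} (hη : η ∈ E.carrier)
    (h : ∀ n, ξ n ≤ η (n / 2)) : ξ ∈ E.carrier := by
  have key : ∀ r, (fun n => if n % 2 = r then ξ n else 0) ∈ E.carrier := fun r => by
    refine (E.exists_mem_norm_le ⟨η, hη⟩ (fun n => n / 2) (fun a ha b hb hab => ?_)
      fun k hk => ?_).1
    · have ha' : a % 2 = r := by by_contra h; simp [h] at ha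
      have hb' : b % 2 = r := by by_contra h; simp [h] at hb
      simp only at hab
      omega
    · have hk' : k % 2 = r := by by_contra h; simp [h] at hk
      simp only [hk', if_true]
      rw [abs_of_nonneg (hξ k)]
      exact (h k).trans (le_abs_self _)
  convert E.carrier.add_mem (key 0) (key 1) using 1
  ext n
  rcases Nat.mod_two_eq_zero_or_one n with h | h <;> simp [h]

end BanachSymmetricSequenceSpace

end Sequences

/-! ### The ideal `C_E` and its norm. -/

section Ideal

variable {H : Type*} [NormedAddCommGroup H] [InnerProductSpace ℂ H] [CompleteSpace H]
  {E : BanachSymmetricSequenceSpace}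

/-- Membership of an operator in `C_E`. -/
def MemSymmetricIdeal (E : BanachSymmetricSequenceSpace) (x : H →L[ℂ] H) : Prop :=
  IsCompactOperator x ∧ singularValue x ∈ E.carrier

/-- The operators in `C_E` of norm at most `r`. -/
def NormLE (E : BanachSymmetricSequenceSpace) (x : H →L[ℂ] H) (r : ℝ) : Prop :=
  ∃ h : singularValue x ∈ E.carrier, E.norm ⟨singularValue x, h⟩ ≤ r

namespace MemSymmetricIdeal

theorem add {x y : H →L[ℂ] H} (hx : MemSymmetricIdeal E x) (hy : MemSymmetricIdeal E y) :
    MemSymmetricIdeal E (x + y) := by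
  refine ⟨hx.1.add hy.1, E.mem_of_le_half (singularValue_nonneg _)
    (E.carrier.add_mem hx.2 hy.2) fun n => ?_⟩
  exact (singularValue_antitone _ (by omega : n / 2 + n / 2 ≤ n)).trans
    (singularValue_add_le hx.1 hy.1 _ _)

theorem of_norm_apply_eq {x y : H →L[ℂ] H} (hx : MemSymmetricIdeal E x)
    (hy : IsCompactOperator y) (h : ∀ v, ‖y v‖ = ‖x v‖) : MemSymmetricIdeal E y :=
  ⟨hy, by rw [singularValue_congr hx.1 hy h]; exact hx.2⟩

theorem neg {x : H →L[ℂ] H} (hx : MemSymmetricIdeal E x) : MemSymmetricIdeal E (-x) :=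
  hx.of_norm_apply_eq hx.1.neg fun v => by simp

theorem sub {x y : H →L[ℂ] H} (hx : MemSymmetricIdeal E x) (hy : MemSymmetricIdeal E y) :
    MemSymmetricIdeal E (x - y) :=
  sub_eq_add_neg x y ▸ hx.add hy.neg

theorem nsmul {x : H →L[ℂ] H} (hx : MemSymmetricIdeal E x) (n : ℕ) :
    MemSymmetricIdeal E (n • x) := by
  induction n with
  | zero => simpa using hx.sub hx
  | succ n ih => rw [succ_nsmul]; exact ih.add hx

theorem of_nonneg_of_le {x y : H →L[ℂ] H} (hx : MemSymmetricIdeal E x) (hy : 0 ≤ y)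
    (h : y ≤ x) : MemSymmetricIdeal E y :=
  ⟨hx.1.of_nonneg_of_le hy h, (E.exists_mem_norm_le_of_abs_le ⟨_, hx.2⟩ fun k => by
    rw [abs_of_nonneg (singularValue_nonneg _ _), abs_of_nonneg (singularValue_nonneg _ _)]
    exact singularValue_le_of_le hx.1 hy h k).1⟩

theorem linearIsometryEquiv_comp {x : H →L[ℂ] H} (hx : MemSymmetricIdeal E x) (U : H ≃ₗᵢ[ℂ] H) :
    MemSymmetricIdeal E ((U : H →L[ℂ] H) * x) :=
  hx.of_norm_apply_eq (hx.1.clm_comp (U : H →L[ℂ] H)) fun _ => U.norm_map _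

theorem normLE_linearIsometryEquiv_comp_iff {x : H →L[ℂ] H} (hx : MemSymmetricIdeal E x)
    (U : H ≃ₗᵢ[ℂ] H) (r : ℝ) : NormLE E ((U : H →L[ℂ] H) * x) r ↔ NormLE E x r := by
  rw [NormLE, NormLE, singularValue_congr (y := (U : H →L[ℂ] H) * x) hx.1
    (hx.linearIsometryEquiv_comp U).1 fun _ => U.norm_map _]

/-- The first singular value dominates `‖x‖`, so the sequence `(‖x‖, 0, 0, …)` lies below the
singular values. This is what makes `N • D` large in `C_E`. -/
theorem opNorm_mul_le_of_normLE {x : H →L[ℂ] H} (hx : MemSymmetricIdeal E x) {r : ℝ}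
    (h : NormLE E x r) : ‖x‖ * E.norm ⟨Pi.single 0 1, E.single_mem⟩ ≤ r := by
  obtain ⟨h1, h2⟩ := h
  obtain ⟨h3, h4⟩ := E.exists_mem_norm_le_of_abs_le (ξ := ‖x‖ • Pi.single 0 1)
    ⟨singularValue x, h1⟩ fun k => by
      rcases eq_or_ne k 0 with rfl | hk
      · simpa [abs_of_nonneg (singularValue_nonneg x 0)] using norm_le_singularValue_zero hx.1
      · simp [hk]
  have h5 : E.norm ⟨‖x‖ • Pi.single 0 1, h3⟩ = ‖x‖ * E.norm ⟨Pi.single 0 1, E.single_mem⟩ := by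
    have := map_smul_eq_mul E.norm ‖x‖ ⟨Pi.single 0 1, E.single_mem⟩
    rwa [norm_norm] at this
  linarith

/-- The sum of an operator below a fixed `x ∈ C_E` and an operator of rank one has norm bounded in
terms of `x` and the operator norm of the second summand. -/
theorem exists_normLE_add {x : H →L[ℂ] H} (hx : MemSymmetricIdeal E x) (C : ℝ) :
    ∃ K : ℝ, 0 < K ∧ ∀ u h : H →L[ℂ] H, 0 ≤ u → u ≤ x → IsCompactOperator h → ‖h‖ ≤ C →
      ∀ w : H, (∀ v, inner ℂ w v = 0 → h v = 0) → NormLE E (u + h) K := by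
  have hs := singularValue_nonneg x
  -- A perturbation of rank at most one shifts singular values by at most one index, so `(s₀(x) + C,
  -- s₀(x), s₁(x), …)` dominates those of `u + h`.
  set η : ℕ → ℝ := fun n => if n = 0 then singularValue x 0 + C else singularValue x (n - 1)
    with hη
  have hηE : η ∈ E.carrier := by
    have h1 : (fun n => if n = 0 then 0 else singularValue x (n - 1)) ∈ E.carrier := by
      refine (E.exists_mem_norm_le ⟨_, hx.2⟩ (fun n => n - 1) (fun a ha b hb hab => ?_)
        fun k hk => ?_).1
      · have ha' : a ≠ 0 := by rintro rfl; simp at ha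
        have hb' : b ≠ 0 := by rintro rfl; simp at hb
        simp only at hab
        omega
      · have hk' : k ≠ 0 := by rintro rfl; simp at hk
        simp [hk']
    convert E.carrier.add_mem h1 (E.carrier.smul_mem (singularValue x 0 + C) E.single_mem) using 1
    ext n
    rcases eq_or_ne n 0 with rfl | hn
    · simp [hη]
    · simp [hη, hn]
  -- The added `1` makes the bound positive, so that it can serve as the radius of a ball.
  refine ⟨E.norm ⟨η, hηE⟩ + 1, by positivity, fun u h hu hux hh hhC w hw => ?_⟩
  have hu' : IsCompactOperator u := hx.1.of_nonneg_of_le hu hux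
  obtain ⟨h1, h2⟩ := E.exists_mem_norm_le_of_abs_le (ξ := singularValue (u + h)) ⟨η, hηE⟩
    fun k => by
      rw [abs_of_nonneg (singularValue_nonneg _ _)]
      refine le_trans ?_ (le_abs_self _)
      rcases k with _ | k
      · refine (singularValue_add_le hu' hh 0 0).trans ?_
        simp only [hη, if_true]
        exact add_le_add (singularValue_le_of_le hx.1 hu hux 0)
          ((singularValue_le_norm h 0).trans hhC)
      · refine (singularValue_add_le hu' hh k 1).trans ?_
        have h3 : singularValue h 1 ≤ 0 := by
          refine singularValue_le_of_norm_le le_rfl (Submodule.span ℂ {w}) ?_ fun v hv => ?_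
          · refine (rank_span_le _).trans ?_
            simp
          · rw [hw v ((Submodule.mem_orthogonal_singleton_iff_inner_right).mp hv)]
            simp
        simp only [hη, Nat.succ_ne_zero, if_false, Nat.add_sub_cancel]
        linarith [singularValue_le_of_le hx.1 hu hux k]
  exact ⟨h1, by linarith⟩

end MemSymmetricIdeal

end Ideal

/-! ### Limits in the ball topology. -/

section BallLimits

variable {H : Type*} [NormedAddCommGroup H] [InnerProductSpace ℂ H] [CompleteSpace H]
  {E : BanachSymmetricSequenceSpace}

/-- The complement of the ball of radius `r` about `-T` is an open neighbourhood of `w`. Convergence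
in the ball topology is used only in this form. -/
theorem SymmetricIdeal.eventually_not_normLE_add {x : ℕ → SymmetricIdeal E H}
    {w : SymmetricIdeal E H}
    (hw : Tendsto x atTop (@nhds _ (SymmetricIdeal.ballTopology E H) w)) {T : H →L[ℂ] H}
    (hT : MemSymmetricIdeal E T) {r : ℝ} (hr : 0 < r) (h : ¬ NormLE E (T + w.1) r) :
    ∀ᶠ n in atTop, ¬ NormLE E (T + (x n).1) r := by
  let c : SymmetricIdeal E H := ⟨-T, hT.neg⟩
  have hmem : ∀ a : SymmetricIdeal E H, a ∈ closedBall c r ↔ NormLE E (T + a.1) r := fun a => by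
    have : a.1 - c.1 = T + a.1 := by simp [c, add_comm]
    show NormLE E (a.1 - c.1) r ↔ _
    rw [this]
  have hopen : @IsOpen _ (ballTopology E H) (closedBall c r)ᶜ :=
    TopologicalSpace.isOpen_generateFrom_of_mem ⟨c, r, hr, rfl⟩
  have hnhds : (closedBall c r)ᶜ ∈ @nhds _ (ballTopology E H) w := by
    let _ := ballTopology E H
    exact hopen.mem_nhds fun h' => h ((hmem w).mp h')
  filter_upwards [hw hnhds] with n hn hn'
  exact hn ((hmem _).mpr hn')

theorem reflection_mul_reflection (K : Submodule ℂ H) [K.HasOrthogonalProjection] :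
    (K.reflection : H →L[ℂ] H) * (K.reflection : H →L[ℂ] H) = 1 := by
  ext v
  exact K.reflection_reflection v

theorem add_reflection_mul_apply (T : H →L[ℂ] H) {e : H} (he : ‖e‖ = 1) (v : H) :
    (T + ((ℂ ∙ e).reflection : H →L[ℂ] H) * T) v = (2 * inner ℂ e (T v)) • e := by
  show T v + (ℂ ∙ e).reflection (T v) = _
  rw [Submodule.reflection_apply, Submodule.starProjection_unit_singleton ℂ he, two_smul,
    mul_smul, two_smul]
  abel

theorem norm_add_reflection_mul_le {T : H →L[ℂ] H} (hT : IsSelfAdjoint T) {e : H}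
    (he : ‖e‖ = 1) : ‖T + ((ℂ ∙ e).reflection : H →L[ℂ] H) * T‖ ≤ 2 * ‖T e‖ := by
  refine ContinuousLinearMap.opNorm_le_bound _ (by positivity) fun v => ?_
  have h : inner ℂ e (T v) = inner ℂ (T e) v := by
    rw [← ContinuousLinearMap.adjoint_inner_left, ← ContinuousLinearMap.star_eq_adjoint,
      hT.star_eq]
  rw [add_reflection_mul_apply T he, norm_smul, he, mul_one, norm_mul, h, mul_assoc,
    Complex.norm_ofNat]
  gcongr
  exact norm_inner_le_norm _ _

/-- The plain `w` is replaced first, with `U w` as part of the fixed summand. Multiplication by `U`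
preserves the norm and turns `U w` into `w`, which is then replaced in the same way, with `n'`
chosen after `n`. -/
theorem SymmetricIdeal.exists_not_normLE_add_reflection {x : ℕ → SymmetricIdeal E H}
    {w : SymmetricIdeal E H}
    (hw : Tendsto x atTop (@nhds _ (SymmetricIdeal.ballTopology E H) w)) {A : H →L[ℂ] H}
    (hA : MemSymmetricIdeal E A) {r : ℝ} (hr : 0 < r)
    (K : Submodule ℂ H) [K.HasOrthogonalProjection]
    (h : ¬ NormLE E (A + (w.1 + (K.reflection : H →L[ℂ] H) * w.1)) r)
    {p : ℕ → Prop} (hp : ∀ᶠ n in atTop, p n) (m : ℕ) :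
    ∃ n ≥ m, ∃ n' ≥ n, p n' ∧
      ¬ NormLE E (A + ((x n).1 + (K.reflection : H →L[ℂ] H) * (x n').1)) r := by
  set U : H →L[ℂ] H := (K.reflection : H →L[ℂ] H) with hU
  have hUU : U * U = 1 := reflection_mul_reflection K
  have hmem : ∀ {T : H →L[ℂ] H}, MemSymmetricIdeal E T → MemSymmetricIdeal E (U * T) :=
    fun hT => hT.linearIsometryEquiv_comp K.reflection
  have hw' : MemSymmetricIdeal E w.1 := w.2
  have hxm : ∀ n, MemSymmetricIdeal E (x n).1 := fun n => (x n).2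
  rw [show A + (w.1 + U * w.1) = (A + U * w.1) + w.1 by abel] at h
  obtain ⟨n, hn, hnm⟩ := ((eventually_not_normLE_add hw (hA.add (hmem hw')) hr h).and
    (eventually_ge_atTop m)).exists
  have h2 : ¬ NormLE E (U * (A + (x n).1) + w.1) r := by
    rw [← (((hA.add (hmem hw')).add (hxm n))).normLE_linearIsometryEquiv_comp_iff
      K.reflection] at hn
    convert hn using 2
    rw [← hU, mul_add, mul_add, mul_add, ← mul_assoc, hUU, one_mul]
    abel
  obtain ⟨n', ⟨hn', hpn⟩, hnn⟩ := (((eventually_not_normLE_add hw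
    (hmem (hA.add (hxm n))) hr h2).and hp).and (eventually_ge_atTop n)).exists
  refine ⟨n, hnm, n', hnn, hpn, ?_⟩
  rw [← ((hA.add ((hxm n).add (hmem (hxm n')))).normLE_linearIsometryEquiv_comp_iff
    K.reflection)]
  convert hn' using 2
  rw [← hU, mul_add, mul_add, mul_add, ← mul_assoc, hUU, one_mul]
  abel

namespace SymmetricIdeal.DecreasesToZero

variable {x : ℕ → SymmetricIdeal E H}

theorem antitone (hx : DecreasesToZero x) : Antitone fun n => (x n).1 :=
  antitone_nat_of_succ_le hx.2.1

theorem tendsto_apply (hx : DecreasesToZero x) (v : H) :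
    Tendsto (fun n => (x n).1 v) atTop (𝓝 0) := by
  obtain ⟨L, hL0, hLx, hL⟩ := exists_tendsto_of_antitone_of_nonneg hx.1 hx.antitone
  have hx0 : MemSymmetricIdeal E (x 0).1 := (x 0).2
  -- The infimum is taken within `C_E`, so the strong limit `L` must belong to it; this follows from
  -- `0 ≤ L ≤ x 0`.
  have h := hx.2.2 ⟨L, hx0.of_nonneg_of_le hL0 (hLx 0)⟩ (IsSelfAdjoint.of_nonneg hL0) hLx
  have hLz : L = 0 := le_antisymm h hL0
  simpa [hLz] using hL v

/-- Replacing the summands of `N • (w + U w)`, where `U` is the reflection in the line spanned by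
`e`, one by one by terms `x n` and `U (x n')` of the sequence. -/
theorem exists_not_normLE (hx : DecreasesToZero x) {w : SymmetricIdeal E H}
    (hw : Tendsto x atTop (@nhds _ (SymmetricIdeal.ballTopology E H) w)) {e : H} (he : ‖e‖ = 1)
    {r : ℝ} (hr : 0 < r) {δ : ℝ} (hδ : 0 < δ) (N k : ℕ)
    (h : ¬ NormLE E ((k + N) • (w.1 + ((ℂ ∙ e).reflection : H →L[ℂ] H) * w.1)) r) :
    ∃ (m : ℕ) (u y : H →L[ℂ] H), 0 ≤ u ∧ u ≤ (x 0).1 - (x m).1 ∧ MemSymmetricIdeal E u ∧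
      MemSymmetricIdeal E y ∧ ‖y + ((ℂ ∙ e).reflection : H →L[ℂ] H) * y‖ ≤ N * δ ∧
      ¬ NormLE E (u + (y + ((ℂ ∙ e).reflection : H →L[ℂ] H) * y) +
        k • (w.1 + ((ℂ ∙ e).reflection : H →L[ℂ] H) * w.1)) r := by
  set U : H →L[ℂ] H := ((ℂ ∙ e).reflection : H →L[ℂ] H) with hU
  have hmem : ∀ {T : H →L[ℂ] H}, MemSymmetricIdeal E T → MemSymmetricIdeal E (U * T) :=
    fun hT => hT.linearIsometryEquiv_comp (ℂ ∙ e).reflection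
  have hw' : MemSymmetricIdeal E w.1 := w.2
  have hxm : ∀ n, MemSymmetricIdeal E (x n).1 := fun n => (x n).2
  have hsmall : ∀ᶠ n in atTop, ‖(x n).1 + U * (x n).1‖ ≤ δ := by
    have h1 : Tendsto (fun n => 2 * ‖(x n).1 e‖) atTop (𝓝 0) := by
      simpa using (hx.tendsto_apply e).norm.const_mul 2
    filter_upwards [h1.eventually (gt_mem_nhds hδ)] with n hn
    exact (norm_add_reflection_mul_le (IsSelfAdjoint.of_nonneg (hx.1 n)) he).trans hn.le
  induction N generalizing k with
  | zero =>
    have h0 : MemSymmetricIdeal E (0 : H →L[ℂ] H) := by simpa using hw'.sub hw'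
    exact ⟨0, 0, 0, le_rfl, by simp, h0, h0, by simp, by simpa using h⟩
  | succ N ih =>
    obtain ⟨m, u, y, hu0, hum, hu, hy, hyN, hnot⟩ := ih (k + 1) (by convert h using 3; ring)
    rw [succ_nsmul, ← add_assoc] at hnot
    obtain ⟨n, hn, n', hn', hsm, hnot'⟩ := exists_not_normLE_add_reflection hw
      ((hu.add (hy.add (hmem hy))).add ((hw'.add (hmem hw')).nsmul k)) hr (ℂ ∙ e) hnot hsmall m
    -- The new difference joins `u` and the term `x n'` joins `y`. Since `n ≥ m`, the difference is
    -- at most `x m - x n'`, and the bound on `u` telescopes.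
    refine ⟨n', u + ((x n).1 - (x n').1), y + (x n').1, ?_, ?_, hu.add ((hxm n).sub (hxm n')),
      hy.add (hxm n'), ?_, ?_⟩
    · exact add_nonneg hu0 (sub_nonneg.mpr (hx.antitone hn'))
    · calc u + ((x n).1 - (x n').1) ≤ ((x 0).1 - (x m).1) + ((x m).1 - (x n').1) :=
            add_le_add hum (sub_le_sub_right (hx.antitone hn) _)
        _ = _ := by abel
    · calc ‖y + (x n').1 + U * (y + (x n').1)‖
          = ‖(y + U * y) + ((x n').1 + U * (x n').1)‖ := by rw [mul_add]; congr 1; abel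
        _ ≤ N * δ + δ := (norm_add_le _ _).trans (add_le_add hyN hsm)
        _ = _ := by push_cast; ring
    · convert hnot' using 2
      rw [mul_add]
      abel

/-- The only possible limit of `xₙ ↓ 0` in the ball topology is `0`. -/
theorem eq_zero_of_tendsto (hx : DecreasesToZero x) {w : SymmetricIdeal E H}
    (hw : Tendsto x atTop (@nhds _ (SymmetricIdeal.ballTopology E H) w)) : w.1 = 0 := by
  by_contra hw0
  obtain ⟨v, hv⟩ : ∃ v, w.1 v ≠ 0 := by
    by_contra! h
    exact hw0 (ContinuousLinearMap.ext h)
  -- With `e` along `w v`, the vector `D v = 2 ‖w v‖ e` is not zero.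
  set e : H := ((‖w.1 v‖⁻¹ : ℝ) : ℂ) • w.1 v with he_def
  have hpos : 0 < ‖w.1 v‖ := norm_pos_iff.mpr hv
  have he : ‖e‖ = 1 := by
    rw [he_def, norm_smul, Complex.norm_real, norm_inv, norm_norm, inv_mul_cancel₀ hpos.ne']
  set U : H →L[ℂ] H := ((ℂ ∙ e).reflection : H →L[ℂ] H) with hU
  have hmem : ∀ {T : H →L[ℂ] H}, MemSymmetricIdeal E T → MemSymmetricIdeal E (U * T) :=
    fun hT => hT.linearIsometryEquiv_comp (ℂ ∙ e).reflection
  have hw' : MemSymmetricIdeal E w.1 := w.2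
  have hx0 : MemSymmetricIdeal E (x 0).1 := (x 0).2
  set D : H →L[ℂ] H := w.1 + U * w.1 with hD
  have hDmem : MemSymmetricIdeal E D := hw'.add (hmem hw')
  have hD0 : 0 < ‖D‖ := by
    refine norm_pos_iff.mpr fun h => ?_
    have h1 : D v = (2 * inner ℂ e (w.1 v)) • e := add_reflection_mul_apply w.1 he v
    have he0 : e ≠ 0 := fun h => by simp [h] at he
    rw [h, zero_apply, eq_comm, smul_eq_zero, or_iff_left he0, he_def, inner_smul_left,
      Complex.conj_ofReal, inner_self_eq_norm_sq_to_K] at h1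
    simp [hv] at h1
  -- `K` depends only on `x 0` and on the bound `1` for the rank-one part, so `N` can be chosen
  -- after it.
  obtain ⟨K, hK, hbound⟩ := hx0.exists_normLE_add 1
  have hκ := E.norm_single_pos
  set κ := E.norm ⟨Pi.single 0 1, E.single_mem⟩ with hκ_def
  obtain ⟨N, hN⟩ := exists_nat_gt (K / (‖D‖ * κ))
  have hN0 : 0 < (N : ℝ) := (by positivity : 0 ≤ K / (‖D‖ * κ)).trans_lt hN
  have hbig : ¬ NormLE E ((0 + N) • D) K := fun h => by
    rw [zero_add] at h
    have h1 := (hDmem.nsmul N).opNorm_mul_le_of_normLE h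
    rw [← Nat.cast_smul_eq_nsmul ℝ, norm_smul, Real.norm_natCast] at h1
    rw [div_lt_iff₀ (by positivity)] at hN
    nlinarith
  -- With tolerance `1 / N` per step, the `N` small terms add up to operator norm at most `1`.
  obtain ⟨m, u, y, hu0, hum, -, hy, hyN, hnot⟩ :=
    hx.exists_not_normLE hw he hK (inv_pos.mpr hN0) N 0 hbig
  rw [mul_inv_cancel₀ hN0.ne'] at hyN
  rw [zero_smul, add_zero] at hnot
  -- `y + U y` maps `v` to a multiple of `⟪e, y v⟫`, hence vanishes on the orthogonal complement of
  -- `y* e`.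
  refine hnot (hbound u _ hu0 (hum.trans (sub_le_self _ (hx.1 m))) (hy.add (hmem hy)).1 hyN
    (ContinuousLinearMap.adjoint y e) fun v hv => ?_)
  rw [ContinuousLinearMap.adjoint_inner_left] at hv
  rw [add_reflection_mul_apply y he, hv]
  simp

end SymmetricIdeal.DecreasesToZero

end BallLimits

end

theorem theorem3p3 {H : Type*} [NormedAddCommGroup H] [InnerProductSpace ℂ H] [CompleteSpace H]
    [TopologicalSpace.SeparableSpace H] (hH : ¬ FiniteDimensional ℂ H)
    (E : BanachSymmetricSequenceSpace) (hE : ∀ ξ ∈ E.carrier, Tendsto ξ atTop (𝓝 0))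
    (x : ℕ → SymmetricIdeal E H) (hx : SymmetricIdeal.DecreasesToZero x)
    (y z : SymmetricIdeal E H)
    (hy : Tendsto x atTop (@nhds _ (SymmetricIdeal.ballTopology E H) y))
    (hz : Tendsto x atTop (@nhds _ (SymmetricIdeal.ballTopology E H) z)) :
    y = z :=
  Subtype.ext ((hx.eq_zero_of_tendsto hy).trans (hx.eq_zero_of_tendsto hz).symm)
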